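/- Let $(\mathbb S,\le)$ be a linearly ordered set. A convolution system $\mathscr S$ over $\mathbb S$ consists of probability spaces $(\Omega_{s,t},\mathcal F_{s,t},\mu_{s,t})$ for $s<t$ in $\mathbb S$ and measurable, measure preserving maps $T_{r,s,t}:\Omega_{r,s}\times\Omega_{s,t}\to\Omega_{r,t}$ for $r<s<t$ such that $T_{r,t,u}(T_{r,s,t}(x,y),z)=T_{r,s,u}(x,T_{s,t,u}(y,z))$ for all $r<s<t<u$, $x\in\Omega_{r,s}$, $y\in\Omega_{s,t}$, $z\in\Omega_{t,u}$. For a projective system of probability spaces $(\Omega_i,\mathcal F_i,\mu_i)$ with measure preserving maps $T_{i,j}:\Omega_j\to\Omega_i$ ($i\le j$) over a directed set, let $\Omega$ be the set of all threads $(\omega_i)_i$, $T_{i,j}(\omega_j)=\omega_i$, with coordinate projections $T_i:\Omega\to\Omega_i$. The system is simply maximal if $\Omega\neq\emptyset$ and every $T_i$ is surjective. It is convergent if it is simply maximal and the set function $T_i^{-1}(A)\mapsto\mu_i(A)$ ($A\in\mathcal F_i$) is $\sigma$-additive on the field $\bigcup_i T_i^{-1}(\mathcal F_i)$; its projective limit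 is then $\Omega$ with the $\sigma$-field generated by this field and the $\sigma$-additive extension of this set function. For a finite set $I=\{\iota_0<\dots<\iota_{m+1}\}\subseteq\mathbb S$ with at least two elements let $(\Omega_I,\mathcal F_I,\mu_I)$ be the product of the spaces $(\Omega_{\iota_k,\iota_{k+1}},\mathcal F_{\iota_k,\iota_{k+1}},\mu_{\iota_k,\iota_{k+1}})$, $0\le k\le m$. If $I\subseteq J$ have the same smallest and the same largest element, let $T_{I,J}:\Omega_J\to\Omega_I$ be the map whose $k$-th component is the iterated multiplication of the coordinates over the points of $J$ in $[\iota_k,\iota_{k+1}]$. For arbitrary $I\subseteq J$ let $X_{I,J}=T_{I,\widetilde I}\circ\pi_{\widetilde I,J}$, where $\widetilde I=J\cap[\min I,\max I]$ and $\pi_{\widetilde I,J}:\Omega_J\to\Omega_{\widetilde I}$ is the coordinate projection. Let $\mathcal K_{s,t}$ be the set of all finite $I\subseteq\mathbb S$ with smallest element $s$ and largest element $t$, and $\mathcal K$ the set of all finite $I\subseteq\mathbb S$ with $|I|\ge2$, both ordered by inclusion. The system $\mathscr S$ is convergent if for all $s<t$ the projective system $\{(\Omega_I,\mathcal F_I,\mu_I),T_{I,J}\}$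 over $\mathcal K_{s,t}$ is convergent, and $K$-convergent if the projective system $\{(\Omega_I,\mathcal F_I,\mu_I),X_{I,J}\}$ over $\mathcal K$ is convergent. Let $\mathscr S$ be convergent. Let $(\Omega^\flat_{s,t},\mathcal F^\flat_{s,t},\mu^\flat_{s,t})$ be the projective limit over $\mathcal K_{s,t}$, with coordinate projections $T^\flat_I$, and for $r<s<t$ let $T^\flat_{r,s,t}:\Omega^\flat_{r,s}\times\Omega^\flat_{s,t}\to\Omega^\flat_{r,t}$ be the isomorphism of probability spaces determined by $T^\flat_I\circ T^\flat_{r,s,t}=T^\flat_{I\cap[r,s]}\times T^\flat_{I\cap[s,t]}$ for all $I\in\mathcal K_{r,t}$ with $s\in I$. For $u\le s<t\le v$ let $T^\flat_{(s,t),(u,v)}:\Omega^\flat_{u,v}\to\Omega^\flat_{s,t}$ be the composition of $(\mathrm{id}\times T^\flat_{s,t,v})^{-1}\circ(T^\flat_{u,s,v})^{-1}:\Omega^\flat_{u,v}\to\Omega^\flat_{u,s}\times\Omega^\flat_{s,t}\times\Omega^\flat_{t,v}$ with the projection onto $\Omega^\flat_{s,t}$, where the first factor is omitted if $u=s$ and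 the last one if $t=v$. These maps form a projective system over the set of pairs $(s,t)$ with $s<t$, ordered by $(s,t)\subseteq(u,v)$ if $u\le s$ and $t\le v$. **Theorem.** Let $\mathscr S$ be a convergent convolution system such that the system of sets $\{\Omega_I,X_{I,J}\}$ over $\mathcal K$ is simply maximal. Then $\mathscr S$ is $K$-convergent if and only if the projective system $\{(\Omega^\flat_{s,t},\mathcal F^\flat_{s,t},\mu^\flat_{s,t}),T^\flat_{(s,t),(u,v)}\}$ is convergent. -/

import Mathlib

open MeasureTheory

universe u v w

/-! ### Projective systems of probability spaces -/

/-- A projective system of probability spaces over a directed set `ι`: probability spaces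
`(Ω i, μ i)` and measure preserving maps `T : Ω j → Ω i` for `i ≤ j`, with `T i i = id` and
`T i j ∘ T j k = T i k`. -/
structure ProjSystem (ι : Type v) [Preorder ι] [IsDirectedOrder ι] where
  Ω : ι → Type u
  [ms : ∀ i, MeasurableSpace (Ω i)]
  μ : ∀ i, Measure (Ω i)
  [prob : ∀ i, IsProbabilityMeasure (μ i)]
  T : ∀ {i j : ι}, i ≤ j → Ω j → Ω i
  measurePreserving : ∀ {i j : ι} (h : i ≤ j), MeasurePreserving (T h) (μ j) (μ i)
  T_refl : ∀ (i : ι) (x : Ω i), T (le_refl i) x = x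
  T_comp : ∀ {i j k : ι} (hij : i ≤ j) (hjk : j ≤ k) (x : Ω k),
    T hij (T hjk x) = T (hij.trans hjk) x

namespace ProjSystem

attribute [instance] ProjSystem.ms ProjSystem.prob

variable {ι : Type v} [Preorder ι] [IsDirectedOrder ι] (P : ProjSystem.{u, v} ι)

/-- The projective limit in the category of sets: the set of all threads. -/
def Limit : Type (max u v) :=
  {ω : ∀ i, P.Ω i // ∀ (i j : ι) (h : i ≤ j), P.T h (ω j) = ω i}

/-- The coordinate projection from the set of threads. -/
def proj (i : ι) (ω : P.Limit) : P.Ω i := ω.1 i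

/-- The join of the σ-fields `(proj i)⁻¹ (ℱ i)`. -/
instance : MeasurableSpace P.Limit := ⨆ i, (P.ms i).comap (P.proj i)

/-- There are threads, and every coordinate projection is surjective. -/
def SimplyMaximal : Prop :=
  Nonempty P.Limit ∧ ∀ i, Function.Surjective (P.proj i)

/-- The field `⋃ i, (proj i)⁻¹ (ℱ i)` of subsets of the set of threads. -/
def cylinders : Set (Set P.Limit) :=
  {A | ∃ (i : ι) (B : Set (P.Ω i)), MeasurableSet B ∧ P.proj i ⁻¹' B = A}

/-- The set function on the field of cylinders that takes the value `μ i B` at `(proj i)⁻¹ B`.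
The infimum is over all ways to write `A` in this form; for a simply maximal system they all give
the same value, see `content_preimage`. -/
noncomputable def content (A : Set P.Limit) : ENNReal :=
  ⨅ (i : ι) (B : Set (P.Ω i)) (_ : MeasurableSet B) (_ : P.proj i ⁻¹' B = A), P.μ i B

/-- The content is σ-additive on the field of cylinders. -/
def SigmaAdditive : Prop :=
  ∀ f : ℕ → Set P.Limit, (∀ n, f n ∈ P.cylinders) → Pairwise (Function.onFun Disjoint f) →
    (⋃ n, f n) ∈ P.cylinders → P.content (⋃ n, f n) = ∑' n, P.content (f n)

/-- A projective system is convergent if it is simply maximal and its content is σ-additive. -/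
def Convergent : Prop := P.SimplyMaximal ∧ P.SigmaAdditive

variable {P}

theorem T_proj {i j : ι} (h : i ≤ j) (ω : P.Limit) : P.T h (P.proj j ω) = P.proj i ω :=
  ω.2 i j h

theorem Limit.ext {ω η : P.Limit} (h : ∀ i, P.proj i ω = P.proj i η) : ω = η :=
  Subtype.ext (funext h)

theorem measurable_proj (i : ι) : Measurable (P.proj i) :=
  (comap_measurable _).mono (le_iSup (fun i => (P.ms i).comap (P.proj i)) i) le_rfl

theorem measurable_to_limit {α : Type w} [MeasurableSpace α] {f : α → P.Limit}
    (h : ∀ i, Measurable fun x => P.proj i (f x)) : Measurable f := by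
  refine Measurable.of_le_map (iSup_le fun i => ?_)
  rw [MeasurableSpace.comap_le_iff_le_map, MeasurableSpace.map_comp]
  exact (h i).le_map

theorem preimage_proj {i j : ι} (h : i ≤ j) (B : Set (P.Ω i)) :
    P.proj i ⁻¹' B = P.proj j ⁻¹' (P.T h ⁻¹' B) := by
  ext ω
  simp [T_proj]

theorem content_preimage (hP : P.SimplyMaximal) {i : ι} {B : Set (P.Ω i)}
    (hB : MeasurableSet B) : P.content (P.proj i ⁻¹' B) = P.μ i B := by
  refine le_antisymm (iInf_le_of_le i (iInf_le_of_le B (iInf_le_of_le hB (iInf_le _ rfl)))) ?_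
  refine le_iInf fun j => le_iInf fun C => le_iInf fun hC => le_iInf fun h => ?_
  obtain ⟨k, hik, hjk⟩ := exists_ge_ge i j
  rw [preimage_proj hik, preimage_proj hjk] at h
  have h' := (hP.2 k).preimage_injective h
  rw [← (P.measurePreserving hik).measure_preimage hB.nullMeasurableSet,
    ← (P.measurePreserving hjk).measure_preimage hC.nullMeasurableSet, h']

theorem cylinders_pair {A B : Set P.Limit} (hA : A ∈ P.cylinders) (hB : B ∈ P.cylinders) :
    ∃ (k : ι) (A' B' : Set (P.Ω k)), MeasurableSet A' ∧ MeasurableSet B' ∧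
      P.proj k ⁻¹' A' = A ∧ P.proj k ⁻¹' B' = B := by
  obtain ⟨i, A', hA', rfl⟩ := hA
  obtain ⟨j, B', hB', rfl⟩ := hB
  obtain ⟨k, hik, hjk⟩ := exists_ge_ge i j
  exact ⟨k, _, _, (P.measurePreserving hik).measurable hA',
    (P.measurePreserving hjk).measurable hB', (preimage_proj hik _).symm,
    (preimage_proj hjk _).symm⟩

theorem isSetRing_cylinders [Nonempty ι] : IsSetRing P.cylinders where
  empty_mem := ⟨Classical.arbitrary ι, ∅, MeasurableSet.empty, rfl⟩
  union_mem := by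
    intro A B hA hB
    obtain ⟨k, A', B', hA', hB', rfl, rfl⟩ := cylinders_pair hA hB
    exact ⟨k, A' ∪ B', hA'.union hB', rfl⟩
  sdiff_mem := by
    intro A B hA hB
    obtain ⟨k, A', B', hA', hB', rfl, rfl⟩ := cylinders_pair hA hB
    exact ⟨k, A' \ B', hA'.diff hB', rfl⟩

theorem generateFrom_cylinders :
    (inferInstance : MeasurableSpace P.Limit) = MeasurableSpace.generateFrom P.cylinders := by
  refine le_antisymm (iSup_le fun i => ?_) (MeasurableSpace.generateFrom_le ?_)
  · rintro _ ⟨B, hB, rfl⟩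
    exact MeasurableSpace.measurableSet_generateFrom ⟨i, B, hB, rfl⟩
  · rintro _ ⟨i, B, hB, rfl⟩
    exact measurable_proj i hB

/-- For a convergent system the content extends to a measure on the σ-field of the limit. -/
theorem exists_limitMeasure [Nonempty ι] (hP : P.Convergent) :
    ∃ m : Measure P.Limit, ∀ (i : ι) (B : Set (P.Ω i)), MeasurableSet B →
      m (P.proj i ⁻¹' B) = P.μ i B := by
  have hR := isSetRing_cylinders (P := P)
  let c : AddContent ENNReal P.cylinders := hR.addContent_of_union P.content
    (by
      have := content_preimage hP.1 (i := Classical.arbitrary ι) MeasurableSet.empty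
      simpa using this)
    (by
      intro A B hA hB hd
      obtain ⟨k, A', B', hA', hB', rfl, rfl⟩ := cylinders_pair hA hB
      rw [← Set.preimage_union, content_preimage hP.1 hA', content_preimage hP.1 hB',
        content_preimage hP.1 (hA'.union hB')]
      exact measure_union
        ((Set.disjoint_preimage_iff (hP.1.2 k)).1 hd) hB')
  have hc : ∀ A, c A = P.content A := fun A => rfl
  have hs : c.IsSigmaSubadditive := by
    refine isSigmaSubadditive_of_addContent_iUnion_eq_tsum hR ?_
    intro f hf hU hd
    simp only [hc]
    exact hP.2 f hf hd hU
  refine ⟨c.measure hR.isSetSemiring generateFrom_cylinders.le hs, fun i B hB => ?_⟩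
  rw [c.measure_eq hR.isSetSemiring generateFrom_cylinders hs ⟨i, B, hB, rfl⟩, hc,
    content_preimage hP.1 hB]

/-- The σ-additive extension of the content of a convergent system. -/
noncomputable def limitMeasure [Nonempty ι] (hP : P.Convergent) : Measure P.Limit :=
  (exists_limitMeasure hP).choose

theorem measurePreserving_proj [Nonempty ι] (hP : P.Convergent) (i : ι) :
    MeasurePreserving (P.proj i) (limitMeasure hP) (P.μ i) := by
  refine ⟨measurable_proj i, Measure.ext fun B hB => ?_⟩
  rw [Measure.map_apply (measurable_proj i) hB]
  exact (exists_limitMeasure hP).choose_spec i B hB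

instance [Nonempty ι] (hP : P.Convergent) : IsProbabilityMeasure (limitMeasure hP) :=
  ⟨by
    rw [← Set.preimage_univ (f := P.proj (Classical.arbitrary ι)),
      (measurePreserving_proj hP _).measure_preimage nullMeasurableSet_univ, measure_univ]⟩

/-- A measure on the limit is determined by its images on a cofinal set of indices. -/
theorem eq_limitMeasure [Nonempty ι] (hP : P.Convergent) (m : Measure P.Limit)
    [IsProbabilityMeasure m] (h : ∀ i, ∃ j, i ≤ j ∧ m.map (P.proj j) = P.μ j) :
    m = limitMeasure hP := by
  refine ext_of_generate_finite P.cylinders generateFrom_cylinders ?_ ?_ (by simp)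
  · intro A hA B hB _
    exact isSetRing_cylinders.inter_mem hA hB
  · rintro _ ⟨i, B, hB, rfl⟩
    obtain ⟨j, hij, hj⟩ := h i
    have hB' := (P.measurePreserving hij).measurable hB
    rw [preimage_proj hij, ← Measure.map_apply (measurable_proj j) hB', hj,
      (measurePreserving_proj hP j).measure_preimage hB'.nullMeasurableSet]

end ProjSystem

/-! ### Convolution systems -/

/-- A convolution system over a linearly ordered set `S`: probability spaces `(Ω s t, μ s t)` for
`s < t` and measure preserving maps `T : Ω r s × Ω s t → Ω r t` for `r < s < t`, which are
associative. -/
structure ConvSystem (S : Type v) [LinearOrder S] where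
  Ω : ∀ s t : S, s < t → Type u
  [ms : ∀ (s t : S) (h : s < t), MeasurableSpace (Ω s t h)]
  μ : ∀ (s t : S) (h : s < t), Measure (Ω s t h)
  [prob : ∀ (s t : S) (h : s < t), IsProbabilityMeasure (μ s t h)]
  T : ∀ {r s t : S} (hrs : r < s) (hst : s < t), Ω r s hrs × Ω s t hst → Ω r t (hrs.trans hst)
  measurePreserving : ∀ {r s t : S} (hrs : r < s) (hst : s < t),
    MeasurePreserving (T hrs hst) ((μ r s hrs).prod (μ s t hst)) (μ r t (hrs.trans hst))
  assoc : ∀ {r s t u : S} (hrs : r < s) (hst : s < t) (htu : t < u)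
    (x : Ω r s hrs) (y : Ω s t hst) (z : Ω t u htu),
    T (hrs.trans hst) htu (T hrs hst (x, y), z) = T hrs (hst.trans htu) (x, T hst htu (y, z))

section Gaps

variable {S : Type v} [LinearOrder S]

/-- `a < b` are consecutive points of the finite set `I`. -/
def IsGap (I : Finset S) (a b : S) : Prop :=
  a ∈ I ∧ b ∈ I ∧ a < b ∧ ∀ c ∈ I, ¬(a < c ∧ c < b)

/-- The pairs of consecutive points of `I`. -/
abbrev Gap (I : Finset S) : Type v := {p : S × S // IsGap I p.1 p.2}

theorem Gap.lt {I : Finset S} (g : Gap I) : g.1.1 < g.1.2 := g.2.2.2.1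

instance (I : Finset S) : Finite (Gap I) :=
  Finite.of_injective (fun g : Gap I => ((⟨g.1.1, g.2.1⟩, ⟨g.1.2, g.2.2.1⟩) : I × I))
    (by
      rintro ⟨⟨a, b⟩, h⟩ ⟨⟨c, d⟩, h'⟩ e
      simpa using e)

noncomputable instance (I : Finset S) : Fintype (Gap I) := Fintype.ofFinite _

/-- The points of `J` in `[a, b]`. -/
def cut (J : Finset S) (a b : S) : Finset S := J.filter fun x => a ≤ x ∧ x ≤ b

theorem mem_cut {J : Finset S} {a b x : S} : x ∈ cut J a b ↔ x ∈ J ∧ a ≤ x ∧ x ≤ b := by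
  simp [cut]

theorem cut_subset (J : Finset S) (a b : S) : cut J a b ⊆ J := Finset.filter_subset _ _

/-- Consecutive points of `J ∩ [a, b]` are consecutive points of `J`. -/
theorem IsGap.of_cut {J : Finset S} {a b x y : S} (h : IsGap (cut J a b) x y) : IsGap J x y := by
  obtain ⟨hx, hy, hxy, hn⟩ := h
  rw [mem_cut] at hx hy
  exact ⟨hx.1, hy.1, hxy, fun c hc hc' =>
    hn c (mem_cut.2 ⟨hc, hx.2.1.trans hc'.1.le, hc'.2.le.trans hy.2.2⟩) hc'⟩

/-- The largest element of `J` below `b`. -/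
noncomputable def prev (J : Finset S) (a b : S) (ha : a ∈ J) (hab : a < b) : S :=
  (J.filter (· < b)).max' ⟨a, Finset.mem_filter.2 ⟨ha, hab⟩⟩

section prev

variable {J : Finset S} {a b : S} (ha : a ∈ J) (hab : a < b)

theorem prev_mem_filter : prev J a b ha hab ∈ J.filter (· < b) := Finset.max'_mem _ _

theorem prev_mem : prev J a b ha hab ∈ J := (Finset.mem_filter.1 (prev_mem_filter ha hab)).1

theorem prev_lt : prev J a b ha hab < b := (Finset.mem_filter.1 (prev_mem_filter ha hab)).2

theorem le_prev {c : S} (hc : c ∈ J) (hcb : c < b) : c ≤ prev J a b ha hab :=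
  Finset.le_max' _ _ (Finset.mem_filter.2 ⟨hc, hcb⟩)

theorem prev_isGap (hb : b ∈ J) : IsGap J (prev J a b ha hab) b :=
  ⟨prev_mem ha hab, hb, prev_lt ha hab, fun _ hc h => (le_prev ha hab hc h.2).not_gt h.1⟩

theorem isGap_of_not_lt_prev (hb : b ∈ J) (h : ¬ a < prev J a b ha hab) : IsGap J a b :=
  ⟨ha, hb, hab, fun _ hc hc' => h (hc'.1.trans_le (le_prev ha hab hc hc'.2))⟩

theorem prev_eq {p : S} (h : IsGap J p b) : prev J a b ha hab = p :=
  le_antisymm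
    (not_lt.1 fun hp => h.2.2.2 _ (prev_mem ha hab) ⟨hp, prev_lt ha hab⟩)
    (le_prev ha hab h.1 h.2.2.1)

theorem card_filter_prev_lt :
    (J.filter (· < prev J a b ha hab)).card < (J.filter (· < b)).card := by
  refine Finset.card_lt_card ⟨fun x hx => ?_, fun h => ?_⟩
  · rw [Finset.mem_filter] at hx ⊢
    exact ⟨hx.1, hx.2.trans (prev_lt ha hab)⟩
  · have := h (prev_mem_filter ha hab)
    simp at this

end prev

/-- Induction along the points of `J` above `a ∈ J`. -/
theorem gap_induction {J : Finset S} {a : S} (ha : a ∈ J)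
    {motive : ∀ b, b ∈ J → a < b → Prop}
    (gap : ∀ b (h : IsGap J a b), motive b h.2.1 h.2.2.1)
    (step : ∀ p b (hp : p ∈ J) (hap : a < p) (h : IsGap J p b), motive p hp hap →
      motive b h.2.1 (hap.trans h.2.2.1)) :
    ∀ b (hb : b ∈ J) (hab : a < b), motive b hb hab := by
  have key : ∀ (n : ℕ) b (hb : b ∈ J) (hab : a < b), (J.filter (· < b)).card = n →
      motive b hb hab := by
    intro n
    induction n using Nat.strong_induction_on with
    | _ n ih =>
      intro b hb hab hn
      by_cases h : a < prev J a b ha hab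
      · exact step _ b (prev_mem ha hab) h (prev_isGap ha hab hb)
          (ih _ (hn ▸ card_filter_prev_lt ha hab) _ _ _ rfl)
      · exact gap b (isGap_of_not_lt_prev ha hab hb h)
  exact fun b hb hab => key _ b hb hab rfl

end Gaps

namespace ConvSystem

attribute [instance] ConvSystem.ms ConvSystem.prob

variable {S : Type v} [LinearOrder S] (𝒮 : ConvSystem.{u, v} S)

/-- `Ω_I`: the product of the spaces `Ω a b` over all pairs `a < b` of consecutive points of `I`,
with the product σ-field. -/
abbrev Space (I : Finset S) : Type (max u v) := ∀ g : Gap I, 𝒮.Ω g.1.1 g.1.2 g.lt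

/-- The product measure `μ_I` on `Ω_I`. -/
noncomputable def measure (I : Finset S) : Measure (𝒮.Space I) :=
  Measure.pi fun g : Gap I => 𝒮.μ g.1.1 g.1.2 g.lt

instance (I : Finset S) : IsProbabilityMeasure (𝒮.measure I) := by
  unfold measure; infer_instance

/-- The coordinate projection `Ω_J → Ω_{J ∩ [a, b]}`. -/
def coordProj (J : Finset S) (a b : S) (ω : 𝒮.Space J) : 𝒮.Space (cut J a b) :=
  fun g => ω ⟨g.1, g.2.of_cut⟩

/-- The iterated multiplication. For `a < b` in `J`, let `a = j₀ < j₁ < ⋯ < jₙ < jₙ₊₁ = b` be the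
points of `J ∩ [a, b]`. The value is `ω` at `(a, b)` if `n = 0`, and otherwise the product `T` of
the iterated multiplication from `a` to `jₙ` and of `ω` at `(jₙ, b)`. -/
noncomputable def iter (J : Finset S) (ω : 𝒮.Space J) (a b : S) (ha : a ∈ J) (hb : b ∈ J)
    (hab : a < b) : 𝒮.Ω a b hab :=
  if h : a < prev J a b ha hab then
    𝒮.T h (prev_lt ha hab)
      (iter J ω a (prev J a b ha hab) ha (prev_mem ha hab) h,
        ω ⟨(prev J a b ha hab, b), prev_isGap ha hab hb⟩)
  else ω ⟨(a, b), isGap_of_not_lt_prev ha hab hb h⟩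
termination_by (J.filter (· < b)).card
decreasing_by exact card_filter_prev_lt ha hab

/-- `T_{I,J} : Ω_J → Ω_I` for `I ⊆ J` (with the same end points): the component at the consecutive
points `a < b` of `I` is the iterated multiplication over the points of `J ∩ [a, b]`. -/
noncomputable def transfer {I J : Finset S} (h : I ⊆ J) (ω : 𝒮.Space J) : 𝒮.Space I :=
  fun g => 𝒮.iter J ω g.1.1 g.1.2 (h g.2.1) (h g.2.2.1) g.lt

variable {𝒮}

theorem iter_gap {J : Finset S} (ω : 𝒮.Space J) {a b : S} (h : IsGap J a b) :
    𝒮.iter J ω a b h.1 h.2.1 h.2.2.1 = ω ⟨(a, b), h⟩ := by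
  rw [iter, dif_neg]
  rw [prev_eq _ _ h]
  exact lt_irrefl a

theorem iter_step {J : Finset S} (ω : 𝒮.Space J) {a p b : S} (ha : a ∈ J) (hap : a < p)
    (h : IsGap J p b) :
    𝒮.iter J ω a b ha h.2.1 (hap.trans h.2.2.1) =
      𝒮.T hap h.2.2.1 (𝒮.iter J ω a p ha h.1 hap, ω ⟨(p, b), h⟩) := by
  have aux : ∀ hab : a < b, 𝒮.iter J ω a b ha h.2.1 hab =
      𝒮.T hap h.2.2.1 (𝒮.iter J ω a p ha h.1 hap, ω ⟨(p, b), h⟩) := by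
    intro hab
    obtain rfl := prev_eq ha hab h
    rw [iter, dif_pos hap]
  exact aux _

theorem iter_mul {J : Finset S} (ω : 𝒮.Space J) {a b c : S} (ha : a ∈ J) (hb : b ∈ J) (hc : c ∈ J)
    (hab : a < b) (hbc : b < c) :
    𝒮.iter J ω a c ha hc (hab.trans hbc) =
      𝒮.T hab hbc (𝒮.iter J ω a b ha hb hab, 𝒮.iter J ω b c hb hc hbc) := by
  refine gap_induction hb (motive := fun c hc hbc => 𝒮.iter J ω a c ha hc (hab.trans hbc) =
      𝒮.T hab hbc (𝒮.iter J ω a b ha hb hab, 𝒮.iter J ω b c hb hc hbc)) ?_ ?_ c hc hbc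
  · intro c h
    rw [iter_step ω ha hab h, iter_gap ω h]
  · intro p c hp hbp h ih
    rw [iter_step ω ha (hab.trans hbp) h, ih, 𝒮.assoc, ← iter_step ω hb hbp h]

/-- A multiplicative family is its own iterated multiplication. -/
theorem iter_unique {J : Finset S} (ω : 𝒮.Space J) {a : S} (ha : a ∈ J)
    (Q : ∀ b, b ∈ J → ∀ h : a < b, 𝒮.Ω a b h)
    (hgap : ∀ b (h : IsGap J a b), Q b h.2.1 h.2.2.1 = ω ⟨(a, b), h⟩)
    (hstep : ∀ p b (hp : p ∈ J) (hap : a < p) (h : IsGap J p b),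
      Q b h.2.1 (hap.trans h.2.2.1) = 𝒮.T hap h.2.2.1 (Q p hp hap, ω ⟨(p, b), h⟩))
    (b : S) (hb : b ∈ J) (hab : a < b) : 𝒮.iter J ω a b ha hb hab = Q b hb hab := by
  refine gap_induction ha (motive := fun b hb hab => 𝒮.iter J ω a b ha hb hab = Q b hb hab)
    ?_ ?_ b hb hab
  · intro b h
    rw [iter_gap ω h, hgap]
  · intro p b hp hap h ih
    rw [iter_step ω ha hap h, hstep p b hp hap h, ih]

theorem iter_transfer {I J : Finset S} (h : I ⊆ J) (ω : 𝒮.Space J) {a b : S} (ha : a ∈ I)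
    (hb : b ∈ I) (hab : a < b) :
    𝒮.iter I (𝒮.transfer h ω) a b ha hb hab = 𝒮.iter J ω a b (h ha) (h hb) hab :=
  iter_unique _ ha (fun b hb hab => 𝒮.iter J ω a b (h ha) (h hb) hab) (fun _ _ => rfl)
    (fun _ _ hp hap hg => iter_mul ω _ (h hp) (h hg.2.1) hap hg.2.2.1) b hb hab

theorem transfer_refl {I : Finset S} (ω : 𝒮.Space I) :
    𝒮.transfer (Finset.Subset.refl I) ω = ω :=
  funext fun g => iter_gap ω g.2

theorem transfer_comp {I J K : Finset S} (hIJ : I ⊆ J) (hJK : J ⊆ K) (ω : 𝒮.Space K) :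
    𝒮.transfer hIJ (𝒮.transfer hJK ω) = 𝒮.transfer (hIJ.trans hJK) ω :=
  funext fun _ => iter_transfer hJK ω _ _ _

theorem coordProj_eq (J : Finset S) (a b : S) (ω : 𝒮.Space J) :
    𝒮.coordProj J a b ω = 𝒮.transfer (cut_subset J a b) ω :=
  funext fun g => (iter_gap ω g.2.of_cut).symm

/-! The iterated multiplications over disjoint blocks are independent. -/

/-- The σ-field generated by the coordinates in `B`. -/
@[reducible] def coordAlg {J : Finset S} (B : Set (Gap J)) : MeasurableSpace (𝒮.Space J) :=
  ⨆ g ∈ B, (𝒮.ms _ _ g.lt).comap fun ω : 𝒮.Space J => ω g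

/-- The consecutive pairs of `J` inside `[a, b]`. -/
def block (J : Finset S) (a b : S) : Set (Gap J) := {g | a ≤ g.1.1 ∧ g.1.2 ≤ b}

theorem coordAlg_mono {J : Finset S} {B C : Set (Gap J)} (h : B ⊆ C) :
    coordAlg (𝒮 := 𝒮) B ≤ coordAlg C :=
  biSup_mono fun _ hg => h hg

theorem measurable_coord {J : Finset S} {B : Set (Gap J)} {g : Gap J} (hg : g ∈ B) :
    Measurable[coordAlg (𝒮 := 𝒮) B] fun ω : 𝒮.Space J => ω g :=
  Measurable.of_comap_le
    (le_biSup (fun g : Gap J => (𝒮.ms _ _ g.lt).comap fun ω : 𝒮.Space J => ω g) hg)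

theorem coordAlg_le {J : Finset S} (B : Set (Gap J)) :
    coordAlg (𝒮 := 𝒮) B ≤ MeasurableSpace.pi :=
  iSup₂_le fun g _ => (measurable_pi_apply g).comap_le

theorem measurable_iter_block {J : Finset S} {a b : S} (ha : a ∈ J) (hb : b ∈ J) (hab : a < b) :
    Measurable[coordAlg (block J a b)] fun ω : 𝒮.Space J => 𝒮.iter J ω a b ha hb hab := by
  refine gap_induction ha (motive := fun b hb hab =>
    Measurable[coordAlg (block J a b)] fun ω : 𝒮.Space J => 𝒮.iter J ω a b ha hb hab)
    ?_ ?_ b hb hab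
  · intro b h
    simp only [iter_gap _ h]
    exact measurable_coord (g := ⟨(a, b), h⟩) ⟨le_rfl, le_rfl⟩
  · intro p b hp hap h ih
    simp only [iter_step _ ha hap h]
    refine (𝒮.measurePreserving hap h.2.2.1).measurable.comp (Measurable.prodMk ?_ ?_)
    · exact ih.mono (coordAlg_mono fun g hg => ⟨hg.1, hg.2.trans h.2.2.1.le⟩) le_rfl
    · exact measurable_coord (g := ⟨(p, b), h⟩) ⟨hap.le, le_rfl⟩

theorem measurable_iter {J : Finset S} {a b : S} (ha : a ∈ J) (hb : b ∈ J) (hab : a < b) :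
    Measurable fun ω : 𝒮.Space J => 𝒮.iter J ω a b ha hb hab :=
  (measurable_iter_block ha hb hab).mono (coordAlg_le _) le_rfl

theorem indep_coordAlg {J : Finset S} {B C : Set (Gap J)} (h : Disjoint B C) :
    ProbabilityTheory.Indep (coordAlg (𝒮 := 𝒮) B) (coordAlg C) (𝒮.measure J) := by
  refine ProbabilityTheory.indep_iSup_of_disjoint (fun g => (measurable_pi_apply g).comap_le) ?_ h
  have := ProbabilityTheory.iIndepFun_pi (μ := fun g : Gap J => 𝒮.μ g.1.1 g.1.2 g.lt)
    (X := fun g x => x) (fun g => measurable_id.aemeasurable)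
  exact (ProbabilityTheory.iIndepFun_iff_iIndep _ _ _).1 this

theorem map_prodMk {J : Finset S} {B C : Set (Gap J)} (h : Disjoint B C) {α β : Type*}
    [MeasurableSpace α] [MeasurableSpace β] {f : 𝒮.Space J → α} {g : 𝒮.Space J → β}
    (hf : Measurable[coordAlg B] f) (hg : Measurable[coordAlg C] g) :
    (𝒮.measure J).map (fun ω => (f ω, g ω)) =
      ((𝒮.measure J).map f).prod ((𝒮.measure J).map g) := by
  have hf' : Measurable f := hf.mono (coordAlg_le _) le_rfl
  have hg' : Measurable g := hg.mono (coordAlg_le _) le_rfl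
  refine (ProbabilityTheory.indepFun_iff_map_prod_eq_prod_map_map hf'.aemeasurable
    hg'.aemeasurable).1 ?_
  rw [ProbabilityTheory.IndepFun_iff_Indep]
  exact ProbabilityTheory.indep_of_indep_of_le_left
    (ProbabilityTheory.indep_of_indep_of_le_right (indep_coordAlg h) hg.comap_le) hf.comap_le

theorem map_iter {J : Finset S} {a b : S} (ha : a ∈ J) (hb : b ∈ J) (hab : a < b) :
    (𝒮.measure J).map (fun ω => 𝒮.iter J ω a b ha hb hab) = 𝒮.μ a b hab := by
  refine gap_induction ha (motive := fun b hb hab =>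
    (𝒮.measure J).map (fun ω => 𝒮.iter J ω a b ha hb hab) = 𝒮.μ a b hab) ?_ ?_ b hb hab
  · intro b h
    simp only [iter_gap _ h]
    exact (measurePreserving_eval (fun g : Gap J => 𝒮.μ g.1.1 g.1.2 g.lt) ⟨(a, b), h⟩).map_eq
  · intro p b hp hap h ih
    simp only [iter_step _ ha hap h]
    have e := map_prodMk (𝒮 := 𝒮) (B := block J a p) (C := {⟨(p, b), h⟩})
      (f := fun ω => 𝒮.iter J ω a p ha h.1 hap) (g := fun ω => ω ⟨(p, b), h⟩)
      (by
        rw [Set.disjoint_singleton_right]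
        exact fun hg => hg.2.not_gt h.2.2.1)
      (measurable_iter_block ha h.1 hap) (measurable_coord rfl)
    have e' : (𝒮.measure J).map (fun ω => ω ⟨(p, b), h⟩) = 𝒮.μ p b h.2.2.1 :=
      (measurePreserving_eval (fun g : Gap J => 𝒮.μ g.1.1 g.1.2 g.lt) ⟨(p, b), h⟩).map_eq
    rw [ih, e'] at e
    rw [← (𝒮.measurePreserving hap h.2.2.1).map_eq, ← e, Measure.map_map
      (𝒮.measurePreserving hap h.2.2.1).measurable
      ((measurable_iter ha h.1 hap).prodMk (measurable_pi_apply _))]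
    rfl

theorem disjoint_block {I J : Finset S} {g g' : Gap I} (h : g ≠ g') :
    Disjoint (block J g.1.1 g.1.2) (block J g'.1.1 g'.1.2) := by
  rw [Set.disjoint_left]
  rintro k ⟨h1, h2⟩ ⟨h3, h4⟩
  have hk := k.lt
  apply h
  have a1 : ¬ (g.1.1 < g'.1.1 ∧ g'.1.1 < g.1.2) := g.2.2.2.2 _ g'.2.1
  have a2 : ¬ (g'.1.1 < g.1.1 ∧ g.1.1 < g'.1.2) := g'.2.2.2.2 _ g.2.1
  have a3 : ¬ (g.1.1 < g'.1.2 ∧ g'.1.2 < g.1.2) := g.2.2.2.2 _ g'.2.2.1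
  have a4 : ¬ (g'.1.1 < g.1.2 ∧ g.1.2 < g'.1.2) := g'.2.2.2.2 _ g.2.2.1
  rw [not_and, not_lt] at a1 a2 a3 a4
  have e1 : g.1.1 = g'.1.1 := by
    refine le_antisymm (not_lt.1 fun hl => ?_) (not_lt.1 fun hl => ?_)
    · exact (a2 hl).not_gt ((h1.trans_lt hk).trans_le h4)
    · exact (a1 hl).not_gt ((h3.trans_lt hk).trans_le h2)
  have e2 : g.1.2 = g'.1.2 := by
    refine le_antisymm (not_lt.1 fun hl => ?_) (not_lt.1 fun hl => ?_)
    · exact (a3 ((h1.trans_lt hk).trans_le h4)).not_gt hl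
    · exact (a4 ((h3.trans_lt hk).trans_le h2)).not_gt hl
  exact Subtype.ext (Prod.ext e1 e2)

theorem transfer_measurePreserving {I J : Finset S} (h : I ⊆ J) :
    MeasurePreserving (𝒮.transfer h) (𝒮.measure J) (𝒮.measure I) := by
  have hm : ∀ g : Gap I, Measurable fun ω : 𝒮.Space J => 𝒮.transfer h ω g := fun g =>
    measurable_iter _ _ _
  refine ⟨measurable_pi_iff.2 hm, ?_⟩
  refine (Measure.pi_eq fun A hA => ?_).symm
  rw [Measure.map_apply (measurable_pi_iff.2 hm) (MeasurableSet.univ_pi hA)]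
  have key : ∀ F : Finset (Gap I), 𝒮.measure J (⋂ g ∈ F, {ω | 𝒮.transfer h ω g ∈ A g}) =
      ∏ g ∈ F, 𝒮.μ g.1.1 g.1.2 g.lt (A g) := by
    intro F
    induction F using Finset.induction_on with
    | empty => simp
    | insert g F hg ih =>
      rw [Finset.set_biInter_insert, Finset.prod_insert hg, ← ih]
      have h1 : 𝒮.μ g.1.1 g.1.2 g.lt (A g) = 𝒮.measure J {ω | 𝒮.transfer h ω g ∈ A g} := by
        rw [← map_iter (J := J) (h g.2.1) (h g.2.2.1) g.lt]
        exact Measure.map_apply (hm g) (hA g)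
      rw [h1]
      have hd : Disjoint (block J g.1.1 g.1.2) (⋃ k ∈ F, block J k.1.1 k.1.2) := by
        simp only [Set.disjoint_iUnion_right]
        intro k hk
        exact disjoint_block (fun e => hg (e ▸ hk))
      refine (ProbabilityTheory.Indep_iff _ _ _).1 (indep_coordAlg hd) _ _ ?_ ?_
      · exact measurable_iter_block _ _ _ (hA g)
      · refine Finset.measurableSet_biInter F fun k hk => ?_
        exact ((measurable_iter_block (h k.2.1) (h k.2.2.1) k.lt).mono
          (coordAlg_mono (Set.subset_biUnion_of_mem (u := fun k : Gap I => block J k.1.1 k.1.2)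
            hk)) le_rfl) (hA k)
  rw [← key Finset.univ]
  congr 1
  ext ω
  simp [Set.mem_pi]

end ConvSystem

/-! ### Finite partitions and the two projective systems of a convolution system -/

section Partitions

variable {S : Type v} [LinearOrder S]

/-- The finite partitions of the interval `[s, t]`, ordered by inclusion. -/
abbrev KPart (s t : S) : Type v :=
  {I : Finset S // s ∈ I ∧ t ∈ I ∧ ∀ x ∈ I, s ≤ x ∧ x ≤ t}

instance (s t : S) : IsDirectedOrder (KPart s t) :=
  ⟨fun I J => ⟨⟨I.1 ∪ J.1, Finset.mem_union_left _ I.2.1, Finset.mem_union_left _ I.2.2.1,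
    fun x hx => (Finset.mem_union.1 hx).elim (I.2.2.2 x) (J.2.2.2 x)⟩,
    Finset.subset_union_left, Finset.subset_union_right⟩⟩

theorem KPart.nonempty {s t : S} (h : s < t) : Nonempty (KPart s t) :=
  ⟨⟨{s, t}, by simp, by simp, by simp [h.le]⟩⟩

variable (S) in
/-- The finite subsets of `S` with at least two elements, ordered by inclusion. -/
abbrev KFin : Type v := {I : Finset S // 2 ≤ I.card}

instance : IsDirectedOrder (KFin S) :=
  ⟨fun I J => ⟨⟨I.1 ∪ J.1, I.2.trans (Finset.card_le_card Finset.subset_union_left)⟩,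
    Finset.subset_union_left, Finset.subset_union_right⟩⟩

theorem KFin.nonempty {S : Type v} (I : KFin S) : I.1.Nonempty :=
  Finset.card_pos.1 (lt_of_lt_of_le two_pos I.2)

/-- For `I ⊆ J`, the points of `J` in the interval spanned by `I`. -/
def refinement (I : KFin S) (J : Finset S) : Finset S :=
  cut J (I.1.min' I.nonempty) (I.1.max' I.nonempty)

theorem subset_refinement {I : KFin S} {J : Finset S} (h : I.1 ⊆ J) : I.1 ⊆ refinement I J :=
  fun x hx => mem_cut.2 ⟨h hx, I.1.min'_le x hx, I.1.le_max' x hx⟩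

variable (S) in
/-- The pairs `(s, t)` with `s < t`, ordered by `(s, t) ≤ (u, v)` if `u ≤ s` and `t ≤ v`. -/
@[ext]
structure Ival where
  fst : S
  snd : S
  lt : fst < snd

instance : PartialOrder (Ival S) where
  le p q := q.fst ≤ p.fst ∧ p.snd ≤ q.snd
  le_refl p := ⟨le_rfl, le_rfl⟩
  le_trans _ _ _ h h' := ⟨h'.1.trans h.1, h.2.trans h'.2⟩
  le_antisymm _ _ h h' := Ival.ext (le_antisymm h'.1 h.1) (le_antisymm h.2 h'.2)

instance : IsDirectedOrder (Ival S) :=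
  ⟨fun p q => ⟨⟨min p.fst q.fst, max p.snd q.snd,
    (min_le_left _ _).trans_lt (p.lt.trans_le (le_max_left _ _))⟩,
    ⟨min_le_left _ _, le_max_left _ _⟩, ⟨min_le_right _ _, le_max_right _ _⟩⟩⟩

end Partitions

namespace ConvSystem

variable {S : Type v} [LinearOrder S] (𝒮 : ConvSystem.{u, v} S)

/-- The projective system `(Ω_I, μ_I), T_{I,J}` over the partitions of `[s, t]`. -/
noncomputable def partSystem (s t : S) : ProjSystem.{max u v, v} (KPart s t) where
  Ω I := 𝒮.Space I.1
  μ I := 𝒮.measure I.1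
  T h := 𝒮.transfer h
  measurePreserving h := transfer_measurePreserving h
  T_refl _ ω := transfer_refl ω
  T_comp hIJ hJK ω := transfer_comp hIJ hJK ω

/-- `X_{I,J} = T_{I,Ĩ} ∘ π : Ω_J → Ω_Ĩ → Ω_I`, where `Ĩ` consists of the points of `J` in the
interval spanned by `I` and `π` is the coordinate projection. If `I` and `J` have the same end
points, then `Ĩ = J` and `X_{I,J} = T_{I,J}`. -/
noncomputable def X {I J : KFin S} (h : I ≤ J) (ω : 𝒮.Space J.1) : 𝒮.Space I.1 :=
  𝒮.transfer (J := refinement I J.1) (subset_refinement h)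
    (𝒮.coordProj J.1 (I.1.min' I.nonempty) (I.1.max' I.nonempty) ω)

variable {𝒮} in
theorem X_eq {I J : KFin S} (h : I ≤ J) (ω : 𝒮.Space J.1) : 𝒮.X h ω = 𝒮.transfer h ω := by
  unfold X
  rw [coordProj_eq]
  exact transfer_comp (subset_refinement h) (cut_subset _ _ _) ω

/-- The projective system `(Ω_I, μ_I), X_{I,J}` over all finite `I ⊆ S` with at least two
elements. -/
noncomputable def kSystem : ProjSystem.{max u v, v} (KFin S) where
  Ω I := 𝒮.Space I.1
  μ I := 𝒮.measure I.1
  T h := 𝒮.X h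
  measurePreserving h := by
    rw [show 𝒮.X h = 𝒮.transfer h from funext (X_eq h)]
    exact transfer_measurePreserving h
  T_refl _ ω := (X_eq _ ω).trans (transfer_refl ω)
  T_comp hIJ hJK ω := by
    rw [X_eq, X_eq, X_eq]
    exact transfer_comp hIJ hJK ω

/-- A convolution system is convergent if for all `s < t` the projective system over the partitions
of `[s, t]` is convergent. -/
def Convergent : Prop := ∀ s t : S, s < t → (𝒮.partSystem s t).Convergent

/-- A convolution system is `K`-convergent if the projective system over all finite subsets of `S`
with at least two elements is convergent. -/
def KConvergent : Prop := 𝒮.kSystem.Convergent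

/-! ### The projective limits over the partitions of the intervals -/

/-- `Ω♭_{s,t}`: the projective limit over the partitions of `[s, t]`. -/
abbrev Flat (s t : S) : Type (max u v) := (𝒮.partSystem s t).Limit

variable {𝒮}

/-- `μ♭_{s,t}`. -/
noncomputable def flatMeasure (h𝒮 : 𝒮.Convergent) {s t : S} (h : s < t) :
    Measure (𝒮.Flat s t) :=
  have := KPart.nonempty h
  ProjSystem.limitMeasure (h𝒮 s t h)

instance (h𝒮 : 𝒮.Convergent) {s t : S} (h : s < t) : IsProbabilityMeasure (flatMeasure h𝒮 h) := by
  have := KPart.nonempty h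
  unfold flatMeasure
  infer_instance

/-- The partition `{s, a, b, t}` of `[s, t]`. -/
def fourPart {s a b t : S} (hsa : s ≤ a) (hab : a < b) (hbt : b ≤ t) : KPart s t :=
  ⟨{s, a, b, t}, by simp, by simp, by
    have h1 := hsa.trans (hab.le.trans hbt)
    simp [h1, hsa, hbt, hsa.trans hab.le, hab.le.trans hbt]⟩

/-- The value of a thread over the partitions of `[s, t]` at a subinterval `[a, b]`. -/
noncomputable def ev {s t : S} (ω : 𝒮.Flat s t) (a b : S) (hsa : s ≤ a) (hab : a < b)
    (hbt : b ≤ t) : 𝒮.Ω a b hab :=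
  𝒮.iter _ (ProjSystem.proj _ (fourPart hsa hab hbt) ω) a b
    (by simp [fourPart]) (by simp [fourPart]) hab

theorem iter_proj {s t : S} (ω : 𝒮.Flat s t) (I : KPart s t) {a b : S} (ha : a ∈ I.1)
    (hb : b ∈ I.1) (hab : a < b) :
    𝒮.iter I.1 (ProjSystem.proj _ I ω) a b ha hb hab =
      ev ω a b (I.2.2.2 a ha).1 hab (I.2.2.2 b hb).2 := by
  have hle : fourPart (I.2.2.2 a ha).1 hab (I.2.2.2 b hb).2 ≤ I := by
    intro x hx
    simp only [fourPart, Finset.mem_insert, Finset.mem_singleton] at hx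
    rcases hx with rfl | rfl | rfl | rfl
    exacts [I.2.1, ha, hb, I.2.2.1]
  unfold ev
  rw [← ProjSystem.T_proj hle ω]
  exact (iter_transfer hle _ _ _ _).symm

theorem proj_gap {s t : S} (ω : 𝒮.Flat s t) (I : KPart s t) (g : Gap I.1) :
    ProjSystem.proj _ I ω g =
      ev ω g.1.1 g.1.2 (I.2.2.2 _ g.2.1).1 g.lt (I.2.2.2 _ g.2.2.1).2 :=
  (iter_gap (ProjSystem.proj _ I ω) g.2).symm.trans (iter_proj ω I g.2.1 g.2.2.1 g.lt)

theorem ev_mul {s t : S} (ω : 𝒮.Flat s t) {a b c : S} (hsa : s ≤ a) (hab : a < b) (hbc : b < c)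
    (hct : c ≤ t) :
    ev ω a c hsa (hab.trans hbc) hct =
      𝒮.T hab hbc (ev ω a b hsa hab (hbc.le.trans hct), ev ω b c (hsa.trans hab.le) hbc hct) := by
  have hac := hab.trans hbc
  let I : KPart s t := ⟨{s, a, b, c, t}, by simp, by simp, by
    have h1 := hsa.trans (hac.le.trans hct)
    simp [h1, hsa, hct, hsa.trans hab.le, hsa.trans hac.le, hbc.le.trans hct, hac.le.trans hct]⟩
  have ha : a ∈ I.1 := by simp [I]
  have hb : b ∈ I.1 := by simp [I]
  have hc : c ∈ I.1 := by simp [I]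
  rw [← iter_proj ω I ha hc hac, ← iter_proj ω I ha hb hab, ← iter_proj ω I hb hc hbc]
  exact iter_mul _ ha hb hc hab hbc

theorem flat_ext {s t : S} {ω η : 𝒮.Flat s t}
    (h : ∀ a b hsa hab hbt, ev ω a b hsa hab hbt = ev η a b hsa hab hbt) : ω = η :=
  ProjSystem.Limit.ext fun I => funext fun g => by rw [proj_gap, proj_gap, h]

/-- The thread defined by a multiplicative family. -/
def mkFlat {s t : S} (f : ∀ a b, s ≤ a → ∀ h : a < b, b ≤ t → 𝒮.Ω a b h)
    (hf : ∀ a b c hsa hab hbc hct, f a c hsa (hab.trans hbc) hct =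
      𝒮.T hab hbc (f a b hsa hab (hbc.le.trans hct), f b c (hsa.trans hab.le) hbc hct)) :
    𝒮.Flat s t :=
  ⟨fun I g => f g.1.1 g.1.2 (I.2.2.2 _ g.2.1).1 g.lt (I.2.2.2 _ g.2.2.1).2, fun _ J h =>
    funext fun g => iter_unique _ (h g.2.1)
      (fun b hb hab => f g.1.1 b (J.2.2.2 _ (h g.2.1)).1 hab (J.2.2.2 _ hb).2) (fun _ _ => rfl)
      (fun _ _ _ _ _ => hf _ _ _ _ _ _ _) _ _ _⟩

theorem ev_mkFlat {s t : S} (f : ∀ a b, s ≤ a → ∀ h : a < b, b ≤ t → 𝒮.Ω a b h)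
    (hf : ∀ a b c hsa hab hbc hct, f a c hsa (hab.trans hbc) hct =
      𝒮.T hab hbc (f a b hsa hab (hbc.le.trans hct), f b c (hsa.trans hab.le) hbc hct))
    (a b hsa hab hbt) : ev (mkFlat f hf) a b hsa hab hbt = f a b hsa hab hbt := by
  have hg : IsGap (fourPart hsa hab hbt).1 a b := by
    refine ⟨by simp [fourPart], by simp [fourPart], hab, fun c hc h => ?_⟩
    simp only [fourPart, Finset.mem_insert, Finset.mem_singleton] at hc
    rcases hc with rfl | rfl | rfl | rfl
    · exact hsa.not_gt h.1
    · exact lt_irrefl _ h.1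
    · exact lt_irrefl _ h.2
    · exact hbt.not_gt h.2
  exact iter_gap _ hg

theorem measurable_ev {s t : S} (a b : S) (hsa : s ≤ a) (hab : a < b) (hbt : b ≤ t) :
    Measurable fun ω : 𝒮.Flat s t => ev ω a b hsa hab hbt :=
  (measurable_iter (𝒮 := 𝒮) _ _ hab).comp
    (ProjSystem.measurable_proj (P := 𝒮.partSystem s t) (fourPart hsa hab hbt))

theorem measurable_to_flat {α : Type w} [MeasurableSpace α] {s t : S} {f : α → 𝒮.Flat s t}
    (h : ∀ a b hsa hab hbt, Measurable fun x => ev (f x) a b hsa hab hbt) : Measurable f :=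
  ProjSystem.measurable_to_limit fun I => measurable_pi_iff.2 fun g => by
    simp only [proj_gap]
    exact h _ _ _ _ _

/-- The restriction of a thread to a subinterval. -/
noncomputable def restrictFlat {s t u v : S} (hus : u ≤ s) (htv : t ≤ v) (ω : 𝒮.Flat u v) :
    𝒮.Flat s t :=
  mkFlat (fun a b hsa hab hbt => ev ω a b (hus.trans hsa) hab (hbt.trans htv))
    (fun _ _ _ _ hab hbc _ => ev_mul ω _ hab hbc _)

/-- The value at `[a, b]` of the concatenation of a thread over `[r, s]` and one over `[s, t]`. -/
noncomputable def concat {r s t : S} (ω : 𝒮.Flat r s) (η : 𝒮.Flat s t) (a b : S) (hra : r ≤ a)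
    (hab : a < b) (hbt : b ≤ t) : 𝒮.Ω a b hab :=
  if hbs : b ≤ s then ev ω a b hra hab hbs
  else if hsa : s ≤ a then ev η a b hsa hab hbt
  else 𝒮.T (not_le.1 hsa) (not_le.1 hbs)
    (ev ω a s hra (not_le.1 hsa) le_rfl, ev η s b le_rfl (not_le.1 hbs) hbt)

theorem concat_mul {r s t : S} (ω : 𝒮.Flat r s) (η : 𝒮.Flat s t) (a b c : S) (hra : r ≤ a)
    (hab : a < b) (hbc : b < c) (hct : c ≤ t) :
    concat ω η a c hra (hab.trans hbc) hct =
      𝒮.T hab hbc (concat ω η a b hra hab (hbc.le.trans hct),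
        concat ω η b c (hra.trans hab.le) hbc hct) := by
  unfold concat
  by_cases hcs : c ≤ s
  · rw [dif_pos hcs, dif_pos hcs, dif_pos (hbc.le.trans hcs), ev_mul ω hra hab hbc hcs]
  by_cases hsa : s ≤ a
  · have hbs : ¬ b ≤ s := fun h => (hab.trans_le h).not_ge hsa
    rw [dif_neg hcs, dif_neg hcs, dif_neg hbs, dif_pos hsa, dif_pos hsa,
      dif_pos (hsa.trans hab.le), ev_mul η hsa hab hbc hct]
  rw [dif_neg hcs, dif_neg hsa, dif_neg hcs]
  rcases lt_trichotomy b s with hbs | rfl | hsb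
  · rw [dif_pos hbs.le, dif_neg (not_le.2 hbs), ev_mul ω hra hab hbs le_rfl, 𝒮.assoc]
  · rw [dif_pos le_rfl, dif_pos le_rfl]
  · rw [dif_neg (not_le.2 hsb), dif_neg hsa, dif_pos hsb.le,
      ev_mul η le_rfl hsb hbc hct, 𝒮.assoc]

/-- The isomorphism `T♭_{r,s,t} : Ω♭_{r,s} × Ω♭_{s,t} → Ω♭_{r,t}`. It is determined by
`T♭_I ∘ T♭_{r,s,t} = T♭_{I ∩ [r,s]} × T♭_{I ∩ [s,t]}` for partitions `I` of `[r, t]` that contain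
`s`, see `flatMul_spec`. -/
noncomputable def flatMul {r s t : S} (hrs : r < s) (hst : s < t) :
    𝒮.Flat r s × 𝒮.Flat s t ≃ᵐ 𝒮.Flat r t where
  toFun x := mkFlat (concat x.1 x.2) (concat_mul x.1 x.2)
  invFun ζ := (restrictFlat le_rfl hst.le ζ, restrictFlat hrs.le le_rfl ζ)
  left_inv x := by
    refine Prod.ext (flat_ext fun a b hra hab hbs => ?_) (flat_ext fun a b hsa hab hbt => ?_)
    · simp only [restrictFlat, ev_mkFlat]
      exact dif_pos hbs
    · simp only [restrictFlat, ev_mkFlat]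
      have hbs : ¬ b ≤ s := fun h => (hab.trans_le h).not_ge hsa
      exact (dif_neg hbs).trans (dif_pos hsa)
  right_inv ζ := by
    refine flat_ext fun a b hra hab hbt => ?_
    simp only [ev_mkFlat, concat, restrictFlat]
    split_ifs with h1 h2
    · rfl
    · rfl
    · exact (ev_mul ζ hra (not_le.1 h2) (not_le.1 h1) hbt).symm
  measurable_toFun := by
    refine measurable_to_flat fun a b hra hab hbt => ?_
    simp only [Equiv.coe_fn_mk, ev_mkFlat, concat]
    split_ifs with h1 h2
    · exact (measurable_ev _ _ _ _ _).comp measurable_fst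
    · exact (measurable_ev _ _ _ _ _).comp measurable_snd
    · exact (𝒮.measurePreserving _ _).measurable.comp
        (((measurable_ev _ _ _ _ _).comp measurable_fst).prodMk
          ((measurable_ev _ _ _ _ _).comp measurable_snd))
  measurable_invFun := by
    refine Measurable.prodMk (measurable_to_flat fun a b hra hab hbt => ?_)
      (measurable_to_flat fun a b hra hab hbt => ?_) <;>
    · simp only [restrictFlat, ev_mkFlat]
      exact measurable_ev _ _ _ _ _

theorem flatMul_symm_fst {r s t : S} (hrs : r < s) (hst : s < t) (ζ : 𝒮.Flat r t) :
    ((flatMul hrs hst).symm ζ).1 = restrictFlat le_rfl hst.le ζ := rfl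

theorem flatMul_symm_snd {r s t : S} (hrs : r < s) (hst : s < t) (ζ : 𝒮.Flat r t) :
    ((flatMul hrs hst).symm ζ).2 = restrictFlat hrs.le le_rfl ζ := rfl

/-- The part of a partition of `[r, t]` in the subinterval `[a, b]` whose end points belong to the
partition. -/
def cutPart {r t : S} (I : KPart r t) {a b : S} (ha : a ∈ I.1) (hb : b ∈ I.1) (hab : a < b) :
    KPart a b :=
  ⟨cut I.1 a b, mem_cut.2 ⟨ha, le_rfl, hab.le⟩, mem_cut.2 ⟨hb, hab.le, le_rfl⟩,
    fun _ hx => (mem_cut.1 hx).2⟩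

theorem coordProj_proj {s t u v : S} (hus : u ≤ s) (hst : s < t) (htv : t ≤ v) (ζ : 𝒮.Flat u v)
    (I : KPart u v) (hs : s ∈ I.1) (ht : t ∈ I.1) :
    𝒮.coordProj I.1 s t (ProjSystem.proj _ I ζ) =
      ProjSystem.proj _ (cutPart I hs ht hst) (restrictFlat hus htv ζ) := by
  funext g
  refine (proj_gap ζ I ⟨g.1, g.2.of_cut⟩).trans ?_
  rw [proj_gap _ (cutPart I hs ht hst) g, restrictFlat, ev_mkFlat]

theorem flatMul_spec {r s t : S} (hrs : r < s) (hst : s < t) (x : 𝒮.Flat r s × 𝒮.Flat s t)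
    (I : KPart r t) (hs : s ∈ I.1) :
    𝒮.coordProj I.1 r s (ProjSystem.proj _ I (flatMul hrs hst x)) =
        ProjSystem.proj _ (cutPart I I.2.1 hs hrs) x.1 ∧
      𝒮.coordProj I.1 s t (ProjSystem.proj _ I (flatMul hrs hst x)) =
        ProjSystem.proj _ (cutPart I hs I.2.2.1 hst) x.2 := by
  rw [coordProj_proj le_rfl hrs hst.le _ I I.2.1 hs, coordProj_proj hrs.le hst le_rfl _ I hs I.2.2.1,
    ← flatMul_symm_fst hrs hst, ← flatMul_symm_snd hrs hst, MeasurableEquiv.symm_apply_apply]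
  exact ⟨rfl, rfl⟩

theorem measurable_coordProj {J : Finset S} (a b : S) :
    Measurable[coordAlg (block J a b)] (𝒮.coordProj J a b) := by
  refine (@measurable_pi_iff _ _ _ (coordAlg _) _ _).2 fun g =>
    measurable_coord (𝒮 := 𝒮) (g := ⟨g.1, g.2.of_cut⟩) ?_
  exact ⟨(mem_cut.1 g.2.1).2.1, (mem_cut.1 g.2.2.1).2.2⟩

theorem map_coordProj (J : Finset S) (a b : S) :
    (𝒮.measure J).map (𝒮.coordProj J a b) = 𝒮.measure (cut J a b) := by
  rw [show 𝒮.coordProj J a b = 𝒮.transfer (cut_subset J a b) from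
    funext (coordProj_eq J a b)]
  exact (transfer_measurePreserving _).map_eq

theorem eq_of_coordProj {r s t : S} (I : KPart r t) (hs : s ∈ I.1) {ω η : 𝒮.Space I.1}
    (h1 : 𝒮.coordProj I.1 r s ω = 𝒮.coordProj I.1 r s η)
    (h2 : 𝒮.coordProj I.1 s t ω = 𝒮.coordProj I.1 s t η) : ω = η := by
  funext g
  have hr := I.2.2.2 _ g.2.1
  have ht := I.2.2.2 _ g.2.2.1
  by_cases h : g.1.2 ≤ s
  · exact congrFun h1 ⟨g.1, mem_cut.2 ⟨g.2.1, hr.1, g.lt.le.trans h⟩, mem_cut.2 ⟨g.2.2.1, ht.1, h⟩,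
      g.lt, fun c hc => g.2.2.2.2 c (mem_cut.1 hc).1⟩
  · have h' : s ≤ g.1.1 := not_lt.1 fun hl => g.2.2.2.2 s hs ⟨hl, not_le.1 h⟩
    exact congrFun h2 ⟨g.1, mem_cut.2 ⟨g.2.1, h', hr.2⟩, mem_cut.2 ⟨g.2.2.1, h'.trans g.lt.le, ht.2⟩,
      g.lt, fun c hc => g.2.2.2.2 c (mem_cut.1 hc).1⟩

/-- Two measures on `Ω_I` agree if their images in `Ω_{I ∩ [r,s]} × Ω_{I ∩ [s,t]}` agree. -/
theorem map_pair_injective {r s t : S} (I : KPart r t) (hs : s ∈ I.1)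
    {m m' : Measure (𝒮.Space I.1)}
    (h : m.map (fun ω => (𝒮.coordProj I.1 r s ω, 𝒮.coordProj I.1 s t ω)) =
      m'.map (fun ω => (𝒮.coordProj I.1 r s ω, 𝒮.coordProj I.1 s t ω))) : m = m' := by
  classical
  have hmeas : Measurable fun ω : 𝒮.Space I.1 =>
      (𝒮.coordProj I.1 r s ω, 𝒮.coordProj I.1 s t ω) :=
    ((measurable_coordProj r s).mono (coordAlg_le _) le_rfl).prodMk
      ((measurable_coordProj s t).mono (coordAlg_le _) le_rfl)
  have hleft : ∀ g : Gap I.1, g.1.2 ≤ s → IsGap (cut I.1 r s) g.1.1 g.1.2 := fun g hg =>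
    ⟨mem_cut.2 ⟨g.2.1, (I.2.2.2 _ g.2.1).1, g.lt.le.trans hg⟩,
      mem_cut.2 ⟨g.2.2.1, (I.2.2.2 _ g.2.2.1).1, hg⟩,
      g.lt, fun c hc => g.2.2.2.2 c (mem_cut.1 hc).1⟩
  have hright : ∀ g : Gap I.1, ¬ g.1.2 ≤ s → IsGap (cut I.1 s t) g.1.1 g.1.2 := fun g hg => by
    have h' : s ≤ g.1.1 := not_lt.1 fun hl => g.2.2.2.2 s hs ⟨hl, not_le.1 hg⟩
    exact ⟨mem_cut.2 ⟨g.2.1, h', (I.2.2.2 _ g.2.1).2⟩,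
      mem_cut.2 ⟨g.2.2.1, h'.trans g.lt.le, (I.2.2.2 _ g.2.2.1).2⟩,
      g.lt, fun c hc => g.2.2.2.2 c (mem_cut.1 hc).1⟩
  let glue : 𝒮.Space (cut I.1 r s) × 𝒮.Space (cut I.1 s t) → 𝒮.Space I.1 := fun x g =>
    if hg : g.1.2 ≤ s then x.1 ⟨g.1, hleft g hg⟩ else x.2 ⟨g.1, hright g hg⟩
  have hglue : Measurable glue := by
    refine measurable_pi_iff.2 fun g => ?_
    by_cases hg : g.1.2 ≤ s
    · simp only [glue, dif_pos hg]
      exact (measurable_pi_apply _).comp measurable_fst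
    · simp only [glue, dif_neg hg]
      exact (measurable_pi_apply _).comp measurable_snd
  have hid : glue ∘ (fun ω => (𝒮.coordProj I.1 r s ω, 𝒮.coordProj I.1 s t ω)) = id := by
    funext ω g
    by_cases hg : g.1.2 ≤ s
    · exact dif_pos hg
    · exact dif_neg hg
  rw [← Measure.map_id (μ := m), ← Measure.map_id (μ := m'), ← hid,
    ← Measure.map_map hglue hmeas, ← Measure.map_map hglue hmeas, h]

theorem flatMul_measurePreserving (h𝒮 : 𝒮.Convergent) {r s t : S} (hrs : r < s) (hst : s < t) :
    MeasurePreserving (flatMul hrs hst) ((flatMeasure h𝒮 hrs).prod (flatMeasure h𝒮 hst))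
      (flatMeasure h𝒮 (hrs.trans hst)) := by
  have := KPart.nonempty hrs
  have := KPart.nonempty hst
  have := KPart.nonempty (hrs.trans hst)
  refine ⟨(flatMul hrs hst).measurable, ?_⟩
  have : IsProbabilityMeasure (((flatMeasure h𝒮 hrs).prod (flatMeasure h𝒮 hst)).map
      (flatMul hrs hst)) :=
    Measure.isProbabilityMeasure_map (flatMul hrs hst).measurable.aemeasurable
  refine ProjSystem.eq_limitMeasure (h𝒮 r t (hrs.trans hst)) _ fun I => ?_
  let J : KPart r t := ⟨insert s I.1, Finset.mem_insert_of_mem I.2.1,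
    Finset.mem_insert_of_mem I.2.2.1, fun x hx => (Finset.mem_insert.1 hx).elim
      (fun e => e ▸ ⟨hrs.le, hst.le⟩) (I.2.2.2 x)⟩
  have hs : s ∈ J.1 := Finset.mem_insert_self _ _
  refine ⟨J, Finset.subset_insert _ _, map_pair_injective J hs ?_⟩
  have hpair : Measurable fun ω : 𝒮.Space J.1 =>
      (𝒮.coordProj J.1 r s ω, 𝒮.coordProj J.1 s t ω) :=
    ((measurable_coordProj r s).mono (coordAlg_le _) le_rfl).prodMk
      ((measurable_coordProj s t).mono (coordAlg_le _) le_rfl)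
  have hd : Disjoint (block J.1 r s) (block J.1 s t) :=
    Set.disjoint_left.2 fun g hg hg' => (hg.2.trans hg'.1).not_gt g.lt
  have e1 := map_prodMk (𝒮 := 𝒮) hd (measurable_coordProj r s) (measurable_coordProj s t)
  rw [map_coordProj, map_coordProj] at e1
  refine Eq.trans ?_ e1.symm
  have hproj : Measurable (ProjSystem.proj (𝒮.partSystem r t) J) := ProjSystem.measurable_proj J
  rw [Measure.map_map hproj (flatMul hrs hst).measurable]
  refine (Measure.map_map hpair (hproj.comp (flatMul hrs hst).measurable)).trans ?_
  have e2 : (fun ω : 𝒮.Space J.1 => (𝒮.coordProj J.1 r s ω, 𝒮.coordProj J.1 s t ω)) ∘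
      (ProjSystem.proj (𝒮.partSystem r t) J ∘ flatMul hrs hst) =
      Prod.map (ProjSystem.proj (𝒮.partSystem r s) (cutPart J J.2.1 hs hrs))
        (ProjSystem.proj (𝒮.partSystem s t) (cutPart J hs J.2.2.1 hst)) := by
    funext x
    have := flatMul_spec hrs hst x J hs
    exact Prod.ext this.1 this.2
  refine (congrArg (fun f => Measure.map f _) e2).trans ?_
  have m1 := ProjSystem.measurePreserving_proj (h𝒮 r s hrs) (cutPart J J.2.1 hs hrs)
  have m2 := ProjSystem.measurePreserving_proj (h𝒮 s t hst) (cutPart J hs J.2.2.1 hst)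
  exact (m1.prod m2).map_eq

/-! ### The projective system over nested intervals -/

/-- For `u ≤ s < v`, the second component of `(T♭_{u,s,v})⁻¹ : Ω♭_{u,v} → Ω♭_{u,s} × Ω♭_{s,v}` if
`u < s`, and the identity if `u = s`. -/
noncomputable def dropLeft {u s v : S} (hus : u ≤ s) (hsv : s < v) (ω : 𝒮.Flat u v) :
    𝒮.Flat s v :=
  if h : u < s then ((flatMul h hsv).symm ω).2
  else (hus.eq_of_not_lt h) ▸ ω

/-- For `s < t ≤ v`, the first component of `(T♭_{s,t,v})⁻¹ : Ω♭_{s,v} → Ω♭_{s,t} × Ω♭_{t,v}` if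
`t < v`, and the identity if `t = v`. -/
noncomputable def dropRight {s t v : S} (hst : s < t) (htv : t ≤ v) (ω : 𝒮.Flat s v) :
    𝒮.Flat s t :=
  if h : t < v then ((flatMul hst h).symm ω).1
  else (htv.eq_of_not_lt h).symm ▸ ω

/-- The map `T♭_{(s,t),(u,v)} : Ω♭_{u,v} → Ω♭_{s,t}`. For `u < s` and `t < v` it is the middle
component of `(id × T♭_{s,t,v})⁻¹ ∘ (T♭_{u,s,v})⁻¹ : Ω♭_{u,v} → Ω♭_{u,s} × Ω♭_{s,t} × Ω♭_{t,v}`. -/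
noncomputable def flatMap {p q : Ival S} (h : p ≤ q) (ω : 𝒮.Flat q.fst q.snd) :
    𝒮.Flat p.fst p.snd :=
  dropRight p.lt h.2 (dropLeft h.1 (p.lt.trans_le h.2) ω)

theorem dropLeft_eq {u s v : S} (hus : u ≤ s) (hsv : s < v) (ω : 𝒮.Flat u v) :
    dropLeft hus hsv ω = restrictFlat hus le_rfl ω := by
  unfold dropLeft
  split_ifs with h
  · rfl
  · obtain rfl := hus.eq_of_not_lt h
    exact flat_ext fun a b hsa hab hbt => (ev_mkFlat _ _ _ _ _ _ _).symm

theorem dropRight_eq {s t v : S} (hst : s < t) (htv : t ≤ v) (ω : 𝒮.Flat s v) :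
    dropRight hst htv ω = restrictFlat le_rfl htv ω := by
  unfold dropRight
  split_ifs with h
  · rfl
  · obtain rfl := htv.eq_of_not_lt h
    exact flat_ext fun a b hsa hab hbt => (ev_mkFlat _ _ _ _ _ _ _).symm

theorem ev_flatMap {p q : Ival S} (h : p ≤ q) (ω : 𝒮.Flat q.fst q.snd) (a b : S)
    (hsa : p.fst ≤ a) (hab : a < b) (hbt : b ≤ p.snd) :
    ev (flatMap h ω) a b hsa hab hbt = ev ω a b (h.1.trans hsa) hab (hbt.trans h.2) := by
  rw [flatMap, dropLeft_eq, dropRight_eq, restrictFlat, ev_mkFlat, restrictFlat, ev_mkFlat]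

theorem dropLeft_measurePreserving (h𝒮 : 𝒮.Convergent) {u s v : S} (hus : u ≤ s) (hsv : s < v) :
    MeasurePreserving (dropLeft (𝒮 := 𝒮) hus hsv) (flatMeasure h𝒮 (hus.trans_lt hsv))
      (flatMeasure h𝒮 hsv) := by
  by_cases h : u < s
  · have e : dropLeft (𝒮 := 𝒮) hus hsv = Prod.snd ∘ (flatMul h hsv).symm :=
      funext fun _ => dif_pos h
    rw [e]
    exact measurePreserving_snd.comp
      ((flatMul_measurePreserving h𝒮 h hsv).symm (flatMul h hsv))
  · obtain rfl := hus.eq_of_not_lt h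
    have e : dropLeft (𝒮 := 𝒮) hus hsv = id := funext fun _ => dif_neg h
    rw [e]
    exact MeasurePreserving.id _

theorem dropRight_measurePreserving (h𝒮 : 𝒮.Convergent) {s t v : S} (hst : s < t) (htv : t ≤ v) :
    MeasurePreserving (dropRight (𝒮 := 𝒮) hst htv) (flatMeasure h𝒮 (hst.trans_le htv))
      (flatMeasure h𝒮 hst) := by
  by_cases h : t < v
  · have e : dropRight (𝒮 := 𝒮) hst htv = Prod.fst ∘ (flatMul hst h).symm :=
      funext fun _ => dif_pos h
    rw [e]
    exact measurePreserving_fst.comp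
      ((flatMul_measurePreserving h𝒮 hst h).symm (flatMul hst h))
  · obtain rfl := htv.eq_of_not_lt h
    have e : dropRight (𝒮 := 𝒮) hst htv = id := funext fun _ => dif_neg h
    rw [e]
    exact MeasurePreserving.id _

/-- The projective system `(Ω♭_{s,t}, μ♭_{s,t}), T♭_{(s,t),(u,v)}` over the pairs `s < t`, ordered
by nesting of intervals, for a convergent convolution system. -/
noncomputable def flatSystem (h𝒮 : 𝒮.Convergent) : ProjSystem.{max u v, v} (Ival S) where
  Ω p := 𝒮.Flat p.fst p.snd
  μ p := flatMeasure h𝒮 p.lt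
  T h := flatMap h
  measurePreserving {p _} h :=
    (dropRight_measurePreserving h𝒮 p.lt h.2).comp
      (dropLeft_measurePreserving h𝒮 h.1 (p.lt.trans_le h.2))
  T_refl _ ω := flat_ext fun _ _ _ _ _ => ev_flatMap _ ω _ _ _ _ _
  T_comp _ _ ω := flat_ext fun _ _ _ _ _ => by rw [ev_flatMap, ev_flatMap, ev_flatMap]

end ConvSystem

/-! A thread of either system carries the same data: values `f a b` in `Ω a b` for all `a < b`,
subject to `f a c = T (f a b, f b c)`. In the system over finite sets, the coordinate at `I` lists
the values at the gaps of `I`. In the system over nested intervals, the coordinate at `(s, t)` is a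
thread over the partitions of `[s, t]`, that is, such a family inside `[s, t]`. Passing through
`MulFamily` gives maps `kToFlat` and `flatToK` between the two sets of threads.

These maps preserve coordinates. A partition of an interval is a finite set (`proj_kToFlat`), and a
finite set is a partition of the interval that it spans (`proj_flatToK`). So the limit measure of
one system, pushed to the threads of the other, has the prescribed marginals: see `map_kToFlat` and
`measurePreserving_flatToK_proj`. By `convergent_of_measure` such a measure, together with simple
maximality, gives convergence. That the two maps are inverse to each other is never needed.

Simple maximality of the system over finite sets is assumed. For the system over nested intervals it
is `surjective_flatSystem_proj`: a thread over one interval extends to all of `S` by gluing it into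
a fixed global thread. Associativity makes the glued family multiplicative. -/

namespace ProjSystem

/-! ### Two criteria for convergence. -/

variable {ι : Type v} [Preorder ι] [IsDirectedOrder ι] {P : ProjSystem.{u, v} ι}

/-- A simply maximal system converges if its set of threads carries a measure that is compatible
with the coordinate projections. -/
theorem convergent_of_measure (hP : P.SimplyMaximal) (m : Measure P.Limit)
    (hm : ∀ i, m.map (P.proj i) = P.μ i) : P.Convergent := by
  -- Surjectivity of the projections makes the content well defined, so it is the restriction of `m`
  -- to the cylinders and inherits σ-additivity.
  have hc : ∀ A ∈ P.cylinders, P.content A = m A := by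
    rintro _ ⟨i, B, hB, rfl⟩
    rw [content_preimage hP hB, ← hm i, Measure.map_apply (measurable_proj i) hB]
  have hmeas : ∀ A ∈ P.cylinders, MeasurableSet A := by
    rintro _ ⟨i, B, hB, rfl⟩
    exact measurable_proj i hB
  refine ⟨hP, fun f hf hd hU => ?_⟩
  rw [hc _ hU, measure_iUnion hd fun n => hmeas _ (hf n)]
  exact tsum_congr fun n => (hc _ (hf n)).symm

/-- A system over an empty index set has no cylinders, so that simple maximality is enough. -/
theorem convergent_of_isEmpty [IsEmpty ι] (hP : P.SimplyMaximal) : P.Convergent :=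
  ⟨hP, fun _ hf => (hf 0).elim fun i _ => isEmptyElim i⟩

end ProjSystem

/-! ### Multiplicative families, the common form of all threads. -/

namespace ConvSystem

variable {S : Type v} [LinearOrder S] (𝒮 : ConvSystem.{u, v} S)

/-- A multiplicative family over the points of `S` that satisfy `P`. -/
structure MulFamily (P : S → Prop) where
  val : ∀ a b, P a → P b → ∀ h : a < b, 𝒮.Ω a b h
  mul : ∀ {a b c} (ha : P a) (hb : P b) (hc : P c) (hab : a < b) (hbc : b < c),
    val a c ha hc (hab.trans hbc) = 𝒮.T hab hbc (val a b ha hb hab, val b c hb hc hbc)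

variable {𝒮}

namespace MulFamily

/-- Concatenation at `s` of a family below `s` and a family above `s`. -/
noncomputable def glue {P Q R : S → Prop} (f : 𝒮.MulFamily P) (g : 𝒮.MulFamily Q) (s : S)
    (hs : R s) (hP : ∀ a, R a → a ≤ s → P a) (hQ : ∀ a, R a → s ≤ a → Q a) :
    𝒮.MulFamily R where
  val a b ha hb hab :=
    if hbs : b ≤ s then f.val a b (hP a ha (hab.le.trans hbs)) (hP b hb hbs) hab
    else if hsa : s ≤ a then g.val a b (hQ a ha hsa) (hQ b hb (hsa.trans hab.le)) hab
    else 𝒮.T (not_le.1 hsa) (not_le.1 hbs)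
      (f.val a s (hP a ha (not_le.1 hsa).le) (hP s hs le_rfl) (not_le.1 hsa),
        g.val s b (hQ s hs le_rfl) (hQ b hb (not_le.1 hbs).le) (not_le.1 hbs))
  mul {a b c} ha hb hc hab hbc := by
    -- If `a`, `b`, `c` lie on one side of `s`, the law is that of `f` or of `g`. No compatibility
    -- of `f` and `g` at `s` is needed, since no nondegenerate interval lies on both sides.
    by_cases hcs : c ≤ s
    · rw [dif_pos hcs, dif_pos hcs, dif_pos (hbc.le.trans hcs)]
      exact f.mul _ _ _ hab hbc
    by_cases hsa : s ≤ a
    · have hbs : ¬ b ≤ s := fun h => (hab.trans_le h).not_ge hsa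
      rw [dif_neg hcs, dif_neg hcs, dif_neg hbs, dif_pos hsa, dif_pos hsa,
        dif_pos (hsa.trans hab.le)]
      exact g.mul _ _ _ hab hbc
    rw [dif_neg hcs, dif_neg hsa, dif_neg hcs]
    -- Here `a < s < c`. For `b = s` the law is the definition; otherwise the factor containing `b`
    -- in its interior is split at `b` and the product is reassociated.
    rcases lt_trichotomy b s with hbs | rfl | hsb
    · rw [dif_pos hbs.le, dif_neg (not_le.2 hbs),
        f.mul _ (hP b hb hbs.le) _ hab hbs, 𝒮.assoc]
    · rw [dif_pos le_rfl, dif_pos le_rfl]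
    · rw [dif_neg (not_le.2 hsb), dif_neg hsa, dif_pos hsb.le,
        g.mul _ (hQ b hb hsb.le) _ hsb hbc, 𝒮.assoc]

/-- The thread over the partitions of `[s, t]` of a family over `S`. -/
noncomputable def toFlat (f : 𝒮.MulFamily fun _ => True) (s t : S) : 𝒮.Flat s t :=
  mkFlat (fun a b _ h _ => f.val a b trivial trivial h) fun _ _ _ _ hab hbc _ =>
    f.mul trivial trivial trivial hab hbc

theorem ev_toFlat (f : 𝒮.MulFamily fun _ => True) (s t a b : S) (hsa : s ≤ a) (hab : a < b)
    (hbt : b ≤ t) : ev (f.toFlat s t) a b hsa hab hbt = f.val a b trivial trivial hab :=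
  ev_mkFlat _ _ _ _ _ _ _

/-- The thread of the flat system of a family over `S`. -/
noncomputable def toFlatLimit (h𝒮 : 𝒮.Convergent) (f : 𝒮.MulFamily fun _ => True) :
    (𝒮.flatSystem h𝒮).Limit :=
  ⟨fun p => f.toFlat p.fst p.snd, fun p q h => by
    refine flat_ext fun a b hsa hab hbt => ?_
    refine (ev_flatMap h (f.toFlat q.fst q.snd) a b hsa hab hbt).trans ?_
    rw [ev_toFlat, ev_toFlat]⟩

/-- The thread over the finite subsets of `S` of a family over `S`. -/
noncomputable def toKLimit (f : 𝒮.MulFamily fun _ => True) : 𝒮.kSystem.Limit :=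
  -- By `X_eq` the thread condition involves only iterated multiplication, and by `iter_unique` the
  -- iterated multiplication of the gap values of `f` returns the values of `f`.
  ⟨fun _ g => f.val g.1.1 g.1.2 trivial trivial g.lt, fun _ _ h => (X_eq h _).trans
    (funext fun g => iter_unique _ (h g.2.1)
      (fun b _ hab => f.val g.1.1 b trivial trivial hab) (fun _ _ => rfl)
      (fun _ _ _ hap hpb => f.mul trivial trivial trivial hap hpb.2.2.1) _ _ _)⟩

end MulFamily

/-- The family of the values of a thread over the partitions of `[s, t]`. -/
noncomputable def flatFamily {s t : S} (ω : 𝒮.Flat s t) :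
    𝒮.MulFamily fun a => s ≤ a ∧ a ≤ t where
  val a b ha hb hab := ev ω a b ha.1 hab hb.2
  mul ha _ hc hab hbc := ev_mul ω ha.1 hab hbc hc.2

/-! ### Threads over the finite subsets -/

/-- The coordinate at `I` consists of iterated products of the coordinate at `J`, and iterating
these over `I` is iterating over `J` at once. -/
theorem iter_kProj_congr (ω : 𝒮.kSystem.Limit) {I J : KFin S} (h : I ≤ J) {a b : S}
    (ha : a ∈ I.1) (hb : b ∈ I.1) (hab : a < b) :
    𝒮.iter I.1 (𝒮.kSystem.proj I ω) a b ha hb hab =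
      𝒮.iter J.1 (𝒮.kSystem.proj J ω) a b (h ha) (h hb) hab := by
  have e : 𝒮.kSystem.proj I ω = 𝒮.transfer h (𝒮.kSystem.proj J ω) :=
    (ProjSystem.T_proj h ω).symm.trans (X_eq h _)
  rw [e]
  exact iter_transfer h _ ha hb hab

/-- The set `{a, b}` for `a < b`. -/
def pairPart {a b : S} (hab : a < b) : KFin S := ⟨{a, b}, (Finset.card_pair hab.ne).ge⟩

/-- The value of a thread over the finite subsets of `S` at an interval `[a, b]`. -/
noncomputable def kEv (ω : 𝒮.kSystem.Limit) (a b : S) (hab : a < b) : 𝒮.Ω a b hab :=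
  𝒮.iter _ (𝒮.kSystem.proj (pairPart hab) ω) a b (by simp [pairPart]) (by simp [pairPart]) hab

/-- The set `{a, b}` is the least index containing both points, so every other such index can be
compared with it. The value at `[a, b]` is thus independent of the index. -/
theorem iter_kProj (ω : 𝒮.kSystem.Limit) (I : KFin S) {a b : S} (ha : a ∈ I.1) (hb : b ∈ I.1)
    (hab : a < b) :
    𝒮.iter I.1 (𝒮.kSystem.proj I ω) a b ha hb hab = kEv ω a b hab := by
  have hle : pairPart hab ≤ I := by
    intro x hx
    simp only [pairPart, Finset.mem_insert, Finset.mem_singleton] at hx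
    rcases hx with rfl | rfl
    exacts [ha, hb]
  exact (iter_kProj_congr ω hle _ _ hab).symm

theorem kProj_gap (ω : 𝒮.kSystem.Limit) (I : KFin S) (g : Gap I.1) :
    𝒮.kSystem.proj I ω g = kEv ω g.1.1 g.1.2 g.lt :=
  (iter_gap (𝒮.kSystem.proj I ω) g.2).symm.trans (iter_kProj ω I g.2.1 g.2.2.1 g.lt)

theorem measurable_kEv (a b : S) (hab : a < b) :
    Measurable fun ω : 𝒮.kSystem.Limit => kEv ω a b hab :=
  (measurable_iter (𝒮 := 𝒮) _ _ hab).comp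
    (ProjSystem.measurable_proj (P := 𝒮.kSystem) (pairPart hab))

/-- The family of the values of a thread over the finite subsets of `S`. -/
noncomputable def kFamily (ω : 𝒮.kSystem.Limit) : 𝒮.MulFamily fun _ => True where
  val a b _ _ hab := kEv ω a b hab
  mul {a b c} _ _ _ hab hbc := by
    -- All three values can be read off at the common index `{a, b, c}`, where `iter_mul` applies.
    let I : KFin S := ⟨{a, b, c}, (Finset.card_pair hab.ne).ge.trans
      (Finset.card_le_card (by intro x; simp; tauto))⟩
    have ha : a ∈ I.1 := by simp [I]
    have hb : b ∈ I.1 := by simp [I]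
    have hc : c ∈ I.1 := by simp [I]
    rw [← iter_kProj ω I ha hc, ← iter_kProj ω I ha hb, ← iter_kProj ω I hb hc]
    exact iter_mul _ ha hb hc hab hbc

/-! ### From finite subsets to nested intervals. -/

/-- The map from the threads over the finite subsets to the threads of the flat system. -/
noncomputable def kToFlat (h𝒮 : 𝒮.Convergent) (ω : 𝒮.kSystem.Limit) : (𝒮.flatSystem h𝒮).Limit :=
  (kFamily ω).toFlatLimit h𝒮

theorem measurable_kToFlat (h𝒮 : 𝒮.Convergent) : Measurable (kToFlat h𝒮) := by
  refine ProjSystem.measurable_to_limit fun p =>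
    measurable_to_flat fun a b hsa hab hbt => ?_
  have e : (fun ω => ev ((𝒮.flatSystem h𝒮).proj p (kToFlat h𝒮 ω)) a b hsa hab hbt) =
      fun ω => kEv ω a b hab :=
    funext fun ω => (kFamily ω).ev_toFlat _ _ _ _ _ _ _
  rw [e]
  exact measurable_kEv a b hab

/-- A partition of `[s, t]` as a finite subset of `S`. -/
def KPart.toKFin {s t : S} (hst : s < t) (I : KPart s t) : KFin S :=
  ⟨I.1, Finset.one_lt_card.2 ⟨s, I.2.1, t, I.2.2.1, hst.ne⟩⟩

/-- Both sides have the value `kEv ω` at each gap of `I`. This is what transports marginals along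
`kToFlat`. -/
theorem proj_kToFlat (h𝒮 : 𝒮.Convergent) (ω : 𝒮.kSystem.Limit) (p : Ival S)
    (I : KPart p.fst p.snd) :
    ProjSystem.proj (𝒮.partSystem p.fst p.snd) I ((𝒮.flatSystem h𝒮).proj p (kToFlat h𝒮 ω)) =
      𝒮.kSystem.proj (KPart.toKFin p.lt I) ω := by
  funext g
  exact (proj_gap _ I g).trans (((kFamily ω).ev_toFlat _ _ _ _ _ _ _).trans
    (kProj_gap ω (KPart.toKFin p.lt I) g).symm)

/-- The measure on the threads over the partitions of `p` is determined by its images on the spaces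
`Ω_I`. By `proj_kToFlat` these images are marginals of the limit measure over the finite sets, hence
equal to `μ_I`. -/
theorem map_kToFlat (h𝒮 : 𝒮.Convergent) [Nonempty (KFin S)] (hK : 𝒮.kSystem.Convergent)
    (p : Ival S) :
    ((ProjSystem.limitMeasure hK).map (kToFlat h𝒮)).map ((𝒮.flatSystem h𝒮).proj p) =
      (𝒮.flatSystem h𝒮).μ p := by
  have := KPart.nonempty p.lt
  have hp := ProjSystem.measurable_proj (P := 𝒮.flatSystem h𝒮) p
  rw [Measure.map_map hp (measurable_kToFlat h𝒮)]
  let q : 𝒮.kSystem.Limit → 𝒮.Flat p.fst p.snd :=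
    fun ω => (𝒮.flatSystem h𝒮).proj p (kToFlat h𝒮 ω)
  have hq : Measurable q := hp.comp (measurable_kToFlat h𝒮)
  have : IsProbabilityMeasure ((ProjSystem.limitMeasure hK).map q) :=
    Measure.isProbabilityMeasure_map hq.aemeasurable
  refine ProjSystem.eq_limitMeasure (h𝒮 _ _ p.lt) ((ProjSystem.limitMeasure hK).map q)
    fun I => ⟨I, le_rfl, ?_⟩
  rw [Measure.map_map (ProjSystem.measurable_proj I) hq]
  refine (congrArg (fun f => Measure.map f _) (funext fun ω => proj_kToFlat h𝒮 ω p I)).trans ?_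
  exact (ProjSystem.measurePreserving_proj hK (KPart.toKFin p.lt I)).map_eq

/-- Every thread over the partitions of an interval extends to `S`, if there is a thread over the
finite subsets of `S` at all: replace the part of the latter in the interval. -/
theorem surjective_flatSystem_proj (h𝒮 : 𝒮.Convergent) (ω : 𝒮.kSystem.Limit) (p : Ival S) :
    Function.Surjective ((𝒮.flatSystem h𝒮).proj p) := by
  intro ζ
  -- Two gluings: `right` follows `ζ` up to `p.snd` and `ω` beyond, and `f` follows `ω` up to
  -- `p.fst` and `right` beyond.
  let right : 𝒮.MulFamily fun a => p.fst ≤ a :=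
    (flatFamily ζ).glue (kFamily ω) p.snd p.lt.le (fun _ h h' => ⟨h, h'⟩) fun _ _ _ => trivial
  let f : 𝒮.MulFamily fun _ => True :=
    (kFamily ω).glue right p.fst trivial (fun _ _ _ => trivial) fun _ _ h => h
  refine ⟨f.toFlatLimit h𝒮, flat_ext fun a b hsa hab hbt => ?_⟩
  refine (f.ev_toFlat _ _ _ _ _ _ _).trans ?_
  -- As `[a, b]` lies inside `p`, the outer gluing selects `right` and the inner one selects `ζ`.
  exact (dif_neg (not_le.2 (hsa.trans_lt hab))).trans ((dif_pos hsa).trans (dif_pos hbt))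

/-! ### Threads of the flat system -/

/-- The transition maps only restrict threads, so enlarging the interval does not change the value
at `[a, b]`. -/
theorem ev_flatSystem_proj {h𝒮 : 𝒮.Convergent} (θ : (𝒮.flatSystem h𝒮).Limit) {p q : Ival S}
    (h : p ≤ q) (a b : S) (hsa : p.fst ≤ a) (hab : a < b) (hbt : b ≤ p.snd) :
    ev ((𝒮.flatSystem h𝒮).proj p θ) a b hsa hab hbt =
      ev ((𝒮.flatSystem h𝒮).proj q θ) a b (h.1.trans hsa) hab (hbt.trans h.2) := by
  rw [← ProjSystem.T_proj h θ]
  exact ev_flatMap h _ a b hsa hab hbt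

/-- The family of the values of a thread of the flat system. -/
noncomputable def flatLimitFamily {h𝒮 : 𝒮.Convergent} (θ : (𝒮.flatSystem h𝒮).Limit) :
    𝒮.MulFamily fun _ => True where
  val a b _ _ hab := ev ((𝒮.flatSystem h𝒮).proj ⟨a, b, hab⟩ θ) a b le_rfl hab le_rfl
  mul {a b c} _ _ _ hab hbc := by
    -- Both factors are moved to the coordinate at `[a, c]`, a single thread to which `ev_mul`
    -- applies.
    rw [ev_flatSystem_proj θ (p := ⟨a, b, hab⟩) (q := ⟨a, c, hab.trans hbc⟩) ⟨le_rfl, hbc.le⟩,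
      ev_flatSystem_proj θ (p := ⟨b, c, hbc⟩) (q := ⟨a, c, hab.trans hbc⟩) ⟨hab.le, le_rfl⟩]
    exact ev_mul _ le_rfl hab hbc le_rfl

/-! ### From nested intervals to finite subsets. -/

/-- The map from the threads of the flat system to the threads over the finite subsets. -/
noncomputable def flatToK {h𝒮 : 𝒮.Convergent} (θ : (𝒮.flatSystem h𝒮).Limit) : 𝒮.kSystem.Limit :=
  (flatLimitFamily θ).toKLimit

/-- The interval spanned by a finite set. -/
def KFin.span (I : KFin S) : Ival S :=
  ⟨I.1.min' I.nonempty, I.1.max' I.nonempty, Finset.min'_lt_max'_of_card _ I.2⟩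

/-- A finite set as a partition of the interval that it spans. -/
def KFin.toKPart (I : KFin S) : KPart (KFin.span I).fst (KFin.span I).snd :=
  ⟨I.1, I.1.min'_mem I.nonempty, I.1.max'_mem I.nonempty, fun x hx => ⟨I.1.min'_le x hx, I.1.le_max' x hx⟩⟩

/-- Every gap of `I` lies in the span of `I`, so its value may be read off at the coordinate of the
span. -/
theorem proj_flatToK {h𝒮 : 𝒮.Convergent} (θ : (𝒮.flatSystem h𝒮).Limit) (I : KFin S) :
    𝒮.kSystem.proj I (flatToK θ) =
      ProjSystem.proj (𝒮.partSystem _ _) (KFin.toKPart I)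
        ((𝒮.flatSystem h𝒮).proj (KFin.span I) θ) := by
  funext g
  refine Eq.trans ?_ (proj_gap _ (KFin.toKPart I) g).symm
  exact ev_flatSystem_proj θ (p := ⟨g.1.1, g.1.2, g.lt⟩) (q := KFin.span I)
    ⟨I.1.min'_le _ g.2.1, I.1.le_max' _ g.2.2.1⟩ _ _ _ _ _

/-- The map factors through the interval spanned by `I`. The first factor preserves measure by
convergence over the intervals, the second by convergence of `𝒮` on that interval. -/
theorem measurePreserving_flatToK_proj {h𝒮 : 𝒮.Convergent} [Nonempty (Ival S)]
    (hF : (𝒮.flatSystem h𝒮).Convergent) (I : KFin S) :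
    MeasurePreserving (fun θ => 𝒮.kSystem.proj I (flatToK θ)) (ProjSystem.limitMeasure hF)
      (𝒮.measure I.1) := by
  have := KPart.nonempty (KFin.span I).lt
  have h1 : MeasurePreserving (ProjSystem.proj (𝒮.partSystem _ _) (KFin.toKPart I))
      ((𝒮.flatSystem h𝒮).μ (KFin.span I)) (𝒮.measure I.1) :=
    ProjSystem.measurePreserving_proj (h𝒮 _ _ (KFin.span I).lt) (KFin.toKPart I)
  have h2 := ProjSystem.measurePreserving_proj hF (KFin.span I)
  rw [show (fun θ => 𝒮.kSystem.proj I (flatToK θ)) = _ from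
    funext fun θ => proj_flatToK (h𝒮 := h𝒮) θ I]
  exact h1.comp h2

end ConvSystem

/-! ### The equivalence. -/

open ConvSystem in
theorem theorem4p6 {S : Type v} [LinearOrder S] (𝒮 : ConvSystem.{u, v} S)
    (h𝒮 : 𝒮.Convergent) (hmax : 𝒮.kSystem.SimplyMaximal) :
    𝒮.KConvergent ↔ (𝒮.flatSystem h𝒮).Convergent := by
  constructor
  · intro hK
    -- One global thread suffices as the background for all gluings.
    obtain ⟨ω⟩ := hmax.1
    have hF : (𝒮.flatSystem h𝒮).SimplyMaximal :=
      ⟨⟨kToFlat h𝒮 ω⟩, surjective_flatSystem_proj h𝒮 ω⟩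
    -- The limit measure is available only for a nonempty index set. If `S` has at most one point,
    -- both index sets are empty and σ-additivity is vacuous.
    rcases isEmpty_or_nonempty (KFin S) with hS | hS
    · have : IsEmpty (Ival S) := ⟨fun p => hS.elim (pairPart p.lt)⟩
      exact ProjSystem.convergent_of_isEmpty hF
    · exact ProjSystem.convergent_of_measure hF _ (map_kToFlat h𝒮 hK)
  · intro hF
    rcases isEmpty_or_nonempty (Ival S) with hS | hS
    · have : IsEmpty (KFin S) := ⟨fun I => hS.elim (KFin.span I)⟩
      exact ProjSystem.convergent_of_isEmpty hmax
    -- The σ-field of the target is generated by its coordinates, so measurability is part of the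
    -- marginal statement.
    · have hmeas : Measurable (flatToK (h𝒮 := h𝒮)) :=
        ProjSystem.measurable_to_limit fun I => (measurePreserving_flatToK_proj hF I).measurable
      refine ProjSystem.convergent_of_measure hmax
        ((ProjSystem.limitMeasure hF).map flatToK) fun I => ?_
      rw [Measure.map_map (ProjSystem.measurable_proj I) hmeas]
      exact (measurePreserving_flatToK_proj hF I).map_eq
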